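/- For a partition $(m_1,\dots,m_q)$ of $n$ ($m_1\ge\dots\ge m_q\ge 1$, $\sum_i m_i=n$) let $J_{m_1,\dots,m_q}=J_{m_1}\oplus\dots\oplus J_{m_q}$, where $J_m$ is the nilpotent $m\times m$ Jordan block (ones on the first upper diagonal, zeros elsewhere), and let $$M_{m_1,\dots,m_q}=\{S\,J_{m_1,\dots,m_q}\,S^{-1} : S\in GL_n(\mathbb C)\}$$ be its similarity orbit in the space of complex $n\times n$ matrices. For partitions $a,b$ of $n$ write $a\succ b$ (``$a$ dominates $b$'') if $M_b\subseteq\overline{M_a}$; this relation is reflexive. For $n=2,\dots,6$, $\succ$ is a partial order on the partitions of $n$. Its Hasse diagram (an arrow $a\to b$ for each covering pair, so that $a\succ b$ if and only if there is a possibly empty path of arrows from $a$ to $b$) is the following. * $n=2$: $(2)\to(1,1)$. * $n=3$: $(3)\to(2,1)\to(1,1,1)$. * $n=4$: $(4)\to(3,1)\to(2,2)\to(2,1,1)\to(1,1,1,1)$. * $n=5$: $(5)\to(4,1)\to(3,2)\to(3,1,1)\to(2,2,1)\to(2,1,1,1)\to(1,1,1,1,1)$. * $n=6$: $(6)\to(5,1)\to(4,2)$;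 $(4,2)\to(4,1,1)$ and $(4,2)\to(3,3)$; $(4,1,1)\to(3,2,1)$ and $(3,3)\to(3,2,1)$; $(3,2,1)\to(3,1,1,1)$ and $(3,2,1)\to(2,2,2)$; $(3,1,1,1)\to(2,2,1,1)$ and $(2,2,2)\to(2,2,1,1)$; $(2,2,1,1)\to(2,1,1,1,1)\to(1,1,1,1,1,1)$. In each case every partition of $n$ occurs exactly once. In particular, the order is total for $n\le5$ in this range, while for $n=6$ it is not: neither of $(4,1,1)$ and $(3,3)$ dominates the other, although $(4,2)$ dominates both. -/

import Mathlib

namespace Degeneracy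

/-- The types of `n`-fold degeneracies: finite lists `(m₁, …, m_q)` of positive integers
in descending order with sum `n` (the sizes of the Jordan blocks). -/
abbrev DegType (n : ℕ) : Type :=
  {m : List ℕ // m.Pairwise (· ≥ ·) ∧ (∀ k ∈ m, 0 < k) ∧ m.sum = n}

/-- The nilpotent Jordan block of size `m`, with ones on the first upper diagonal. -/
def jordanBlock (m : ℕ) : Matrix (Fin m) (Fin m) ℂ :=
  Matrix.of fun i j => if (j : ℕ) = (i : ℕ) + 1 then 1 else 0

theorem sum_blocks {n : ℕ} (m : DegType n) : ∑ i : Fin m.1.length, m.1.get i = n := by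
  have h := m.2.2.2
  rw [← List.sum_ofFn, List.ofFn_get]
  exact h

/-- The positions `0, …, n - 1` are split, in order, into consecutive intervals of lengths
`m₁, …, m_q`. -/
def blockEquiv {n : ℕ} (m : DegType n) :
    (Σ i : Fin m.1.length, Fin (m.1.get i)) ≃ Fin n :=
  finSigmaFinEquiv.trans (finCongr (sum_blocks m))

/-- The Jordan normal form `J_{m₁} ⊕ ⋯ ⊕ J_{m_q}` as an `n × n` matrix. -/
def jordanForm {n : ℕ} (m : DegType n) : Matrix (Fin n) (Fin n) ℂ :=
  Matrix.reindex (blockEquiv m) (blockEquiv m)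
    (Matrix.blockDiagonal' fun i : Fin m.1.length => jordanBlock (m.1.get i))

/-- The degeneracy manifold `{S J S⁻¹ | S ∈ GL_n(ℂ)}`. -/
def manifold {n : ℕ} (m : DegType n) : Set (Matrix (Fin n) (Fin n) ℂ) :=
  {A | ∃ S : Matrix.GeneralLinearGroup (Fin n) ℂ,
    A = (S : Matrix (Fin n) (Fin n) ℂ) * jordanForm m *
      ((S⁻¹ : Matrix.GeneralLinearGroup (Fin n) ℂ) : Matrix (Fin n) (Fin n) ℂ)}

/-- `a` dominates `b` (`a ≻ b`): the manifold of `b` lies in the closure of that of `a`. -/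
def Dominates {n : ℕ} (a b : DegType n) : Prop :=
  manifold b ⊆ closure (manifold a)

/-- `a` covers `b` in the dominance relation: `a ≻ b`, `a ≠ b`, and no third type lies in
between. -/
def DomCovers {n : ℕ} (a b : DegType n) : Prop :=
  Dominates a b ∧ a ≠ b ∧ ∀ c : DegType n, Dominates a c → Dominates c b → c = a ∨ c = b

/-- The directed graph with the given nodes and arrows is the hierarchy of `n`-fold
degeneracies: the nodes are the types, each listed once; dominance is a partial order; one type
dominates another exactly if there is a (possibly empty) path along the arrows from the first
to the second; and the arrows are exactly the covering pairs. -/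
def IsHierarchy (n : ℕ) (nodes : List (List ℕ)) (arrows : List (List ℕ × List ℕ)) : Prop :=
  nodes.Nodup ∧
  (∀ m : List ℕ, m ∈ nodes ↔ m.Pairwise (· ≥ ·) ∧ (∀ k ∈ m, 0 < k) ∧ m.sum = n) ∧
  ((∀ a : DegType n, Dominates a a) ∧
    (∀ a b c : DegType n, Dominates a b → Dominates b c → Dominates a c) ∧
    (∀ a b : DegType n, Dominates a b → Dominates b a → a = b)) ∧
  (∀ a b : DegType n, Dominates a b ↔
    Relation.ReflTransGen (fun x y : List ℕ => (x, y) ∈ arrows) a.1 b.1) ∧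
  (∀ x y : List ℕ, (x, y) ∈ arrows ↔
    ∃ a b : DegType n, a.1 = x ∧ b.1 = y ∧ DomCovers a b)

/-- Dominance of `n`-fold degeneracies is total: any two types are comparable. -/
def DomTotal (n : ℕ) : Prop :=
  ∀ a b : DegType n, Dominates a b ∨ Dominates b a

end Degeneracy

/-!
The manifold of `a` consists of the matrices `A` that have Jordan generators: vectors `g i` with
`A ^ aᵢ *ᵥ g i = 0` whose images under the powers of `A` span `ℂⁿ` (`mem_manifold_iff`). As the
`aᵢ` add up to `n`, spanning already forces the `A ^ j *ᵥ g i` with `j < aᵢ` to be a basis.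

Two facts determine the dominance relation.

* Upper bound (`Dominates.rankLE`): linear independence is an open condition, so the rank of
  `A ^ k`, which is `∑ i, (aᵢ - k)` with truncated subtraction, cannot increase in the limit.
* Lower bound (`Dominates.of_isBoxMove`): let `b` arise from `a` by moving one box from block `r`
  to block `s`, with `b_s ≤ b_r`. If `B` has generators `g` with block sizes `b`, and `E` sends
  `g s` to `g r` and kills the rest of the Jordan basis, then for `ε ≠ 0` the matrix `B + ε E` has
  block sizes `a`: the new generators of the blocks `r` and `s` are `g s` and `B *ᵥ g s`.

For each `n` in question, every arrow of the diagram is a box move, and whenever the rank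
inequalities hold for a pair of types, there is a path of arrows between them. Hence dominance,
the rank inequalities and reachability coincide, and the claims about covers, totality and
incomparable pairs are finite computations with lists (`HierarchyCheck`).
-/

namespace Degeneracy

open Matrix

/-! ### Jordan generators -/

/-- The vectors `g i` generate `ℂⁿ` under the powers of `A`, and `g i` is annihilated by
`A ^ m i`. When `∑ i, m i = n`, this says that the `A ^ j *ᵥ g i` with `j < m i` form a Jordan
basis of the nilpotent matrix `A`, with blocks of sizes `m i`. Sizes `0` are allowed. -/
def IsJordanGen {n : ℕ} {ι : Type*} (A : Matrix (Fin n) (Fin n) ℂ) (m : ι → ℕ)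
    (g : ι → Fin n → ℂ) : Prop :=
  (∀ i, A ^ m i *ᵥ g i = 0) ∧
    Submodule.span ℂ (Set.range fun p : ι × ℕ => A ^ p.2 *ᵥ g p.1) = ⊤

theorem pow_add_mulVec {n : ℕ} (A : Matrix (Fin n) (Fin n) ℂ) (j k : ℕ) (v : Fin n → ℂ) :
    A ^ (j + k) *ᵥ v = A ^ j *ᵥ (A ^ k *ᵥ v) := by
  rw [pow_add, mulVec_mulVec]

theorem pow_mulVec_eq_zero_of_le {n : ℕ} {A : Matrix (Fin n) (Fin n) ℂ} {j k : ℕ}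
    {v : Fin n → ℂ} (h : A ^ k *ᵥ v = 0) (hkj : k ≤ j) : A ^ j *ᵥ v = 0 := by
  obtain ⟨d, rfl⟩ := Nat.exists_eq_add_of_le' hkj
  rw [pow_add_mulVec, h, mulVec_zero]

namespace IsJordanGen

variable {n : ℕ} {ι : Type*} {A : Matrix (Fin n) (Fin n) ℂ} {m : ι → ℕ} {g : ι → Fin n → ℂ}

theorem pow_mulVec_eq_zero (h : IsJordanGen A m g) {i : ι} {j : ℕ} (hj : m i ≤ j) :
    A ^ j *ᵥ g i = 0 :=
  pow_mulVec_eq_zero_of_le (h.1 i) hj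

theorem span_chains (h : IsJordanGen A m g) :
    Submodule.span ℂ (Set.range fun p : Σ i, Fin (m i) => A ^ (p.2 : ℕ) *ᵥ g p.1) = ⊤ := by
  rw [eq_top_iff, ← h.2, Submodule.span_le]
  rintro _ ⟨⟨i, j⟩, rfl⟩
  by_cases hj : j < m i
  · exact Submodule.subset_span ⟨⟨i, j, hj⟩, rfl⟩
  · change A ^ j *ᵥ g i ∈ _
    rw [h.pow_mulVec_eq_zero (not_lt.1 hj)]
    exact Submodule.zero_mem _

theorem linearIndependent_chains [Fintype ι] (h : IsJordanGen A m g) (hm : ∑ i, m i = n) :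
    LinearIndependent ℂ fun p : Σ i, Fin (m i) => A ^ (p.2 : ℕ) *ᵥ g p.1 := by
  apply linearIndependent_of_top_le_span_of_card_eq_finrank h.span_chains.ge
  simp [hm]

/-- The range of `A ^ k` is spanned by the `A ^ (k + j) *ᵥ g i` with `k + j < m i`. -/
theorem finrank_range_pow_le [Fintype ι] (h : IsJordanGen A m g) (k : ℕ) :
    Module.finrank ℂ (LinearMap.range (A ^ k).mulVecLin) ≤ ∑ i, (m i - k) := by
  have key : LinearMap.range (A ^ k).mulVecLin ≤
      Submodule.span ℂ (Set.range fun p : Σ i, Fin (m i - k) => A ^ (k + p.2) *ᵥ g p.1) := by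
    rw [LinearMap.range_eq_map, ← h.2, Submodule.map_span, Submodule.span_le]
    rintro _ ⟨_, ⟨⟨i, j⟩, rfl⟩, rfl⟩
    simp only [mulVecLin_apply, ← pow_add_mulVec]
    by_cases hj : j < m i - k
    · exact Submodule.subset_span ⟨⟨i, j, hj⟩, rfl⟩
    · rw [h.pow_mulVec_eq_zero (by omega)]
      exact Submodule.zero_mem _
  refine (Submodule.finrank_mono key).trans ((finrank_range_le_card _).trans ?_)
  simp

theorem linearIndependent_pow [Fintype ι] (h : IsJordanGen A m g) (hm : ∑ i, m i = n) (k : ℕ) :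
    LinearIndependent ℂ fun p : Σ i, Fin (m i - k) => A ^ (k + p.2) *ᵥ g p.1 := by
  refine (h.linearIndependent_chains hm).comp
    (fun p : Σ i, Fin (m i - k) => (⟨p.1, k + p.2, by omega⟩ : Σ i, Fin (m i))) ?_
  rintro ⟨i, j⟩ ⟨i', j'⟩ hp
  obtain rfl : i = i' := congrArg (fun q : Σ i, Fin (m i) => q.1) hp
  have : k + (j : ℕ) = k + j' := congrArg (fun q : Σ i, Fin (m i) => (q.2 : ℕ)) hp
  rw [Fin.ext (by omega : (j : ℕ) = j')]

theorem conj (h : IsJordanGen A m g) (S : GL (Fin n) ℂ) :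
    IsJordanGen (S.1 * A * (S⁻¹ : GL (Fin n) ℂ).1) m fun i => S.1 *ᵥ g i := by
  have key (j : ℕ) (v : Fin n → ℂ) :
      (S.1 * A * (S⁻¹ : GL (Fin n) ℂ).1) ^ j *ᵥ (S.1 *ᵥ v) = S.1 *ᵥ (A ^ j *ᵥ v) := by
    rw [Units.conj_pow, mulVec_mulVec, mul_assoc, Units.inv_mul, mul_one, mulVec_mulVec]
  refine ⟨fun i => by rw [key, h.1, mulVec_zero], ?_⟩
  have hS : Function.Surjective S.1.mulVec := mulVec_surjective_iff_isUnit.2 S.isUnit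
  have hr : LinearMap.range S.1.mulVecLin = ⊤ := LinearMap.range_eq_top.2 hS
  rw [← hr, LinearMap.range_eq_map, ← h.2, Submodule.map_span, ← Set.range_comp]
  congr 2
  funext p
  exact key p.2 (g p.1)

/-! ### Moving a box between two blocks -/

/-- The first vector of one chain can be sent to any vector `w` by a matrix that kills the rest
of the Jordan basis. -/
theorem exists_mulVec_eq [Fintype ι] [DecidableEq ι] (h : IsJordanGen A m g)
    (hm : ∑ i, m i = n) {s : ι} (hs : 0 < m s) (w : Fin n → ℂ) :
    ∃ E : Matrix (Fin n) (Fin n) ℂ,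
      ∀ i j, E *ᵥ (A ^ j *ᵥ g i) = if i = s ∧ j = 0 then w else 0 := by
  let b := Module.Basis.mk (h.linearIndependent_chains hm) h.span_chains.ge
  refine ⟨LinearMap.toMatrix' (b.constr ℂ fun p => if p.1 = s ∧ (p.2 : ℕ) = 0 then w else 0),
    fun i j => ?_⟩
  rw [LinearMap.toMatrix'_mulVec]
  by_cases hj : j < m i
  · have hb : A ^ j *ᵥ g i = b ⟨i, j, hj⟩ := by simp [b]
    rw [hb, Module.Basis.constr_basis]
  · rw [h.pow_mulVec_eq_zero (not_lt.1 hj), map_zero, if_neg]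
    rintro ⟨rfl, rfl⟩
    exact hj hs

/-- If `g` generates with block sizes `m'`, where `m'` arises from `m` by moving one box from
block `r` to a shorter block `s`, then `A` is a limit of matrices with block sizes `m`.
The perturbation sends `g s` to `A *ᵥ g s + ε • g r`; then `g s` starts a chain of length `m r`
that reaches `g r`, and `A *ᵥ g s` starts the rest of the old chain. -/
theorem exists_perturbation [Fintype ι] [DecidableEq ι] {m' : ι → ℕ} (h : IsJordanGen A m' g)
    (hm' : ∑ i, m' i = n) {r s : ι} (hrs : r ≠ s) (hr : m r = m' r + 1) (hs : m' s = m s + 1)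
    (hle : m' s ≤ m' r) (hoff : ∀ i, i ≠ r → i ≠ s → m i = m' i) :
    ∃ E : Matrix (Fin n) (Fin n) ℂ, ∀ ε : ℂ, ε ≠ 0 → ∃ g', IsJordanGen (A + ε • E) m g' := by
  obtain ⟨E, hE⟩ := h.exists_mulVec_eq hm' (s := s) (by omega) (g r)
  refine ⟨E, fun ε hε => ?_⟩
  -- Away from the first vector of the chain of `s`, the perturbed matrix acts like `A`.
  have step (i : ι) (j : ℕ) (hij : ¬(i = s ∧ j = 0)) :
      (A + ε • E) *ᵥ (A ^ j *ᵥ g i) = A ^ (j + 1) *ᵥ g i := by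
    rw [add_mulVec, smul_mulVec, hE, if_neg hij, smul_zero, add_zero, mulVec_mulVec, pow_succ']
  have step0 : (A + ε • E) *ᵥ g s = A *ᵥ g s + ε • g r := by
    have := hE s 0
    rw [pow_zero, one_mulVec, if_pos ⟨rfl, rfl⟩] at this
    rw [add_mulVec, smul_mulVec, this]
  have pow_eq (i : ι) (l : ℕ) (hil : ¬(i = s ∧ l = 0)) (j : ℕ) :
      (A + ε • E) ^ j *ᵥ (A ^ l *ᵥ g i) = A ^ (j + l) *ᵥ g i := by
    induction j with
    | zero => simp
    | succ j ih =>
      rw [pow_succ', ← mulVec_mulVec, ih, step i (j + l) fun h => hil ⟨h.1, by omega⟩]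
      congr 2; omega
  have pow_eq0 (i : ι) (hi : i ≠ s) (j : ℕ) : (A + ε • E) ^ j *ᵥ g i = A ^ j *ᵥ g i := by
    simpa using pow_eq i 0 (by tauto) j
  have pow_eq1 (j : ℕ) : (A + ε • E) ^ j *ᵥ (A *ᵥ g s) = A ^ (j + 1) *ᵥ g s := by
    simpa using pow_eq s 1 (by omega) j
  let g' : ι → Fin n → ℂ := fun i => if i = r then g s else if i = s then A *ᵥ g s else g i
  have g'r : g' r = g s := by simp [g']
  have g's : g' s = A *ᵥ g s := by simp [g', hrs.symm]
  have g'off (i : ι) (hir : i ≠ r) (his : i ≠ s) : g' i = g i := by simp [g', hir, his]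
  refine ⟨g', fun i => ?_, ?_⟩
  · rcases eq_or_ne i r with rfl | hir
    · rw [g'r, hr, pow_succ, ← mulVec_mulVec, step0, mulVec_add, mulVec_smul, pow_eq1,
        pow_eq0 _ hrs, h.1,
        h.pow_mulVec_eq_zero (i := s) (by omega), smul_zero, add_zero]
    rcases eq_or_ne i s with rfl | his
    · rw [g's, pow_eq1, ← hs, h.1]
    · rw [g'off i hir his, pow_eq0 i his, hoff i hir his, h.1]
  · set W := Submodule.span ℂ (Set.range fun p : ι × ℕ => (A + ε • E) ^ p.2 *ᵥ g' p.1)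
    have mem (i : ι) (j : ℕ) : (A + ε • E) ^ j *ᵥ g' i ∈ W := Submodule.subset_span ⟨(i, j), rfl⟩
    have memr (j : ℕ) : (A + ε • E) ^ j *ᵥ g r ∈ W := by
      have h1 : ε • ((A + ε • E) ^ j *ᵥ g r) =
          (A + ε • E) ^ (j + 1) *ᵥ g' r - (A + ε • E) ^ j *ᵥ g' s := by
        rw [g'r, g's, pow_add_mulVec, pow_one, step0, mulVec_add, mulVec_smul]
        abel
      exact (W.smul_mem_iff hε).1 (h1 ▸ W.sub_mem (mem _ _) (mem _ _))
    rw [eq_top_iff, ← h.2, Submodule.span_le]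
    rintro _ ⟨⟨i, j⟩, rfl⟩
    change A ^ j *ᵥ g i ∈ W
    rcases eq_or_ne i s with rfl | his
    · rcases j with _ | j
      · simpa [g'r] using mem r 0
      · rw [← pow_eq1, ← g's]
        exact mem _ _
    rw [← pow_eq0 i his]
    rcases eq_or_ne i r with rfl | hir
    · exact memr j
    · rw [← g'off i hir his]
      exact mem _ _

end IsJordanGen

/-! ### The manifolds in terms of generators -/

variable {n : ℕ}

/-- The block sizes of `a`, padded with zeros to a family indexed by `Fin n`. -/
def size (a : List ℕ) (i : Fin n) : ℕ := a.getD i 0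

theorem DegType.length_le (a : DegType n) : a.1.length ≤ n :=
  (List.length_le_sum_of_one_le _ a.2.2.1).trans_eq a.2.2.2

theorem sum_size {l : List ℕ} (h : l.length ≤ n) : ∑ i : Fin n, size l i = l.sum := by
  induction l generalizing n with
  | nil => simp [size]
  | cons k l ih =>
    obtain ⟨n, rfl⟩ := Nat.exists_eq_add_of_le' (Nat.le_of_add_left_le h)
    rw [Fin.sum_univ_succ, List.sum_cons, ← ih (n := n) (by simpa using h)]
    simp [size]

theorem DegType.sum_size (a : DegType n) : ∑ i : Fin n, size a.1 i = n :=
  (Degeneracy.sum_size a.length_le).trans a.2.2.2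

theorem size_castLE (a : DegType n) (i : Fin a.1.length) :
    size a.1 (i.castLE a.length_le) = a.1.get i := by
  simp [size]

theorem jordanForm_blockEquiv (a : DegType n) (p q : Σ i : Fin a.1.length, Fin (a.1.get i)) :
    jordanForm a (blockEquiv a p) (blockEquiv a q) =
      if p.1 = q.1 ∧ (q.2 : ℕ) = p.2 + 1 then 1 else 0 := by
  obtain ⟨i, j⟩ := p
  obtain ⟨i', j'⟩ := q
  simp only [jordanForm, reindex_apply, submatrix_apply, Equiv.symm_apply_apply,
    blockDiagonal'_apply]
  by_cases h : i = i'
  · subst h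
    simp [jordanBlock]
  · simp [h]

/-- The `j`-th standard basis vector of the `i`-th block, or `0` if `j` is out of range. -/
def blockVec (a : DegType n) (i : Fin a.1.length) (j : ℕ) : Fin n → ℂ :=
  if h : j < a.1.get i then Pi.single (blockEquiv a ⟨i, j, h⟩) 1 else 0

theorem jordanForm_mulVec_blockVec_zero (a : DegType n) (i : Fin a.1.length) :
    jordanForm a *ᵥ blockVec a i 0 = 0 := by
  unfold blockVec
  split_ifs with h
  · ext x
    obtain ⟨p, rfl⟩ := (blockEquiv a).surjective x
    simp [jordanForm_blockEquiv]
  · simp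

theorem jordanForm_mulVec_blockVec_succ (a : DegType n) (i : Fin a.1.length) {j : ℕ}
    (hj : j + 1 < a.1.get i) : jordanForm a *ᵥ blockVec a i (j + 1) = blockVec a i j := by
  rw [blockVec, dif_pos hj, blockVec, dif_pos (by omega)]
  ext x
  obtain ⟨⟨i', j'⟩, rfl⟩ := (blockEquiv a).surjective x
  rw [mulVec_single_one, col_apply, jordanForm_blockEquiv, Pi.single_apply]
  simp only [EmbeddingLike.apply_eq_iff_eq]
  congr 1
  rw [eq_iff_iff]
  constructor
  · rintro ⟨h1, h2⟩
    dsimp at h1 h2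
    subst h1
    rw [Sigma.mk.injEq]
    exact ⟨rfl, heq_of_eq (Fin.ext (by simp; omega))⟩
  · intro h
    obtain ⟨rfl, h⟩ := Sigma.mk.inj h
    rw [eq_of_heq h]
    simp

theorem jordanForm_pow_mulVec_blockVec (a : DegType n) (i : Fin a.1.length) {s t : ℕ}
    (h : t + s < a.1.get i) : jordanForm a ^ t *ᵥ blockVec a i (t + s) = blockVec a i s := by
  induction t with
  | zero => simp
  | succ t ih =>
    rw [pow_succ, ← mulVec_mulVec, Nat.succ_add, jordanForm_mulVec_blockVec_succ a i (by omega),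
      ih (by omega)]

theorem isJordanGen_jordanForm (a : DegType n) :
    ∃ g, IsJordanGen (jordanForm a) (size (n := n) a.1) g := by
  let g : Fin n → Fin n → ℂ := fun i =>
    if h : (i : ℕ) < a.1.length then blockVec a ⟨i, h⟩ (a.1.get ⟨i, h⟩ - 1) else 0
  refine ⟨g, fun i => ?_, ?_⟩
  · by_cases h : (i : ℕ) < a.1.length
    · have hs : size a.1 i = a.1.get ⟨i, h⟩ := size_castLE a ⟨i, h⟩
      have h0 : 0 < a.1.get ⟨i, h⟩ := a.2.2.1 _ (List.get_mem _ _)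
      obtain ⟨d, hd⟩ := Nat.exists_eq_add_of_lt h0
      have := jordanForm_pow_mulVec_blockVec a ⟨i, h⟩ (s := 0) (t := d) (by omega)
      rw [hs, show g i = blockVec a ⟨i, h⟩ (a.1.get ⟨i, h⟩ - 1) from dif_pos h, hd,
        show 0 + d + 1 = 1 + d by omega, pow_add_mulVec, show 1 + d - 1 = d + 0 by omega, this,
        pow_one, jordanForm_mulVec_blockVec_zero]
    · rw [show g i = 0 from dif_neg h, mulVec_zero]
  · rw [eq_top_iff, ← (Pi.basisFun ℂ (Fin n)).span_eq, Submodule.span_le]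
    rintro _ ⟨x, rfl⟩
    obtain ⟨⟨i, j⟩, rfl⟩ := (blockEquiv a).surjective x
    have hj := j.2
    refine Submodule.subset_span ⟨(i.castLE a.length_le, a.1.get i - 1 - j), ?_⟩
    have hg : g (i.castLE a.length_le) = blockVec a i (a.1.get i - 1) := dif_pos i.2
    have := jordanForm_pow_mulVec_blockVec a i (s := j) (t := a.1.get i - 1 - j) (by omega)
    dsimp only
    rw [hg, Pi.basisFun_apply]
    rw [show a.1.get i - 1 - j + j = a.1.get i - 1 by omega] at this
    rw [this, blockVec, dif_pos hj]

theorem exists_col_eq {κ : Type*} (e : κ ≃ Fin n) (w : κ → Fin n → ℂ) :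
    ∃ S : Matrix (Fin n) (Fin n) ℂ, ∀ p, S.col (e p) = w p :=
  ⟨Matrix.of fun x y => w (e.symm y) x, fun p => by ext; simp⟩

/-- Membership in the manifold of `a` means having a Jordan basis with block sizes `a`. -/
theorem mem_manifold_iff (a : DegType n) (A : Matrix (Fin n) (Fin n) ℂ) :
    A ∈ manifold a ↔ ∃ g, IsJordanGen A (size (n := n) a.1) g := by
  constructor
  · rintro ⟨S, rfl⟩
    obtain ⟨g, hg⟩ := isJordanGen_jordanForm a
    exact ⟨_, hg.conj S⟩
  · rintro ⟨g, hg⟩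
    let v (i : Fin a.1.length) (j : ℕ) : Fin n → ℂ :=
      A ^ (a.1.get i - 1 - j) *ᵥ g (i.castLE a.length_le)
    -- The columns of `S` are the Jordan basis generated by `g`, each chain in reversed order.
    obtain ⟨S, hScol⟩ := exists_col_eq (blockEquiv a) fun p => v p.1 p.2
    have hS (i : Fin a.1.length) (j : ℕ) (hj : j < a.1.get i) : S *ᵥ blockVec a i j = v i j := by
      rw [blockVec, dif_pos hj, mulVec_single_one, hScol]
    have hunit : IsUnit S := by
      rw [← mulVec_surjective_iff_isUnit]
      suffices h : LinearMap.range S.mulVecLin = ⊤ from LinearMap.range_eq_top.1 h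
      rw [eq_top_iff, ← hg.2, Submodule.span_le]
      rintro _ ⟨⟨i, j⟩, rfl⟩
      by_cases hj : j < size a.1 i
      · have hi : (i : ℕ) < a.1.length := by
          by_contra hi
          rw [size, List.getD_eq_default _ _ (not_lt.1 hi)] at hj
          omega
        have hs : size a.1 i = a.1.get ⟨i, hi⟩ := size_castLE a ⟨i, hi⟩
        refine ⟨blockVec a ⟨i, hi⟩ (size a.1 i - 1 - j), ?_⟩
        rw [mulVecLin_apply, hS _ _ (by omega)]
        simp only [v, ← hs]
        congr 2
        omega
      · dsimp only
        rw [hg.pow_mulVec_eq_zero (not_lt.1 hj)]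
        exact Submodule.zero_mem _
    have hAS : A * S = S * jordanForm a := by
      refine Matrix.ext_col fun y => ?_
      obtain ⟨⟨i, j⟩, rfl⟩ := (blockEquiv a).surjective y
      have hcol (M : Matrix (Fin n) (Fin n) ℂ) :
          M.col (blockEquiv a ⟨i, j⟩) = M *ᵥ blockVec a i j := by
        rw [blockVec, dif_pos j.2, mulVec_single_one]
      rw [hcol, hcol, ← mulVec_mulVec, ← mulVec_mulVec, hS _ _ j.2]
      have hA : A *ᵥ v i j = A ^ (a.1.get i - 1 - j + 1) *ᵥ g (i.castLE a.length_le) := by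
        rw [mulVec_mulVec, pow_succ']
      obtain ⟨j, hj⟩ := j
      dsimp only at hA ⊢
      rw [hA]
      rcases j with _ | j
      · rw [jordanForm_mulVec_blockVec_zero, mulVec_zero]
        exact hg.pow_mulVec_eq_zero (by rw [size_castLE]; omega)
      · rw [jordanForm_mulVec_blockVec_succ a i hj, hS _ _ (by omega)]
        simp only [v]
        congr 2
        omega
    refine ⟨hunit.unit, ?_⟩
    change A = S * jordanForm a * _
    rw [← hAS, mul_assoc]
    change A = A * (hunit.unit.1 * _)
    rw [Units.mul_inv, mul_one]

/-! ### The dominance relation -/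

theorem Dominates.refl (a : DegType n) : Dominates a a := subset_closure

theorem Dominates.trans {a b c : DegType n} (hab : Dominates a b) (hbc : Dominates b c) :
    Dominates a c :=
  Set.Subset.trans hbc (closure_minimal hab isClosed_closure)

theorem manifold_nonempty (a : DegType n) : (manifold a).Nonempty :=
  ⟨_, (mem_manifold_iff a _).2 (isJordanGen_jordanForm a)⟩

/-- The comparison of the ranks of all powers: the sum `∑ i, (size a i - k)`, with truncated
subtraction, is the rank of `A ^ k` for `A` in the manifold of `a`. Powers with `k ≥ n` vanish. -/
def RankLE (n : ℕ) (b a : List ℕ) : Prop :=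
  ∀ k < n, ∑ i : Fin n, (size b i - k) ≤ ∑ i : Fin n, (size a i - k)

instance (n : ℕ) (b a : List ℕ) : Decidable (RankLE n b a) :=
  inferInstanceAs (Decidable (∀ k < n, _))

/-- The ranks of the powers cannot drop under small perturbations, because linear independence
is an open condition. -/
theorem Dominates.rankLE {a b : DegType n} (h : Dominates a b) : RankLE n b.1 a.1 := by
  intro k _
  obtain ⟨B, hB⟩ := manifold_nonempty b
  obtain ⟨g, hg⟩ := (mem_manifold_iff b B).1 hB
  let F (A : Matrix (Fin n) (Fin n) ℂ) (p : Σ i : Fin n, Fin (size b.1 i - k)) : Fin n → ℂ :=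
    A ^ (k + p.2) *ᵥ g p.1
  have hF : Continuous F :=
    continuous_pi fun p => (continuous_pow _).matrix_mulVec continuous_const
  have hopen : IsOpen {A | LinearIndependent ℂ (F A)} :=
    isOpen_setOfPred_linearIndependent.preimage hF
  obtain ⟨A, hA, hAa⟩ := mem_closure_iff.1 (h hB) _ hopen (hg.linearIndependent_pow b.sum_size k)
  obtain ⟨g', hg'⟩ := (mem_manifold_iff a A).1 hAa
  refine le_trans ?_ (hg'.finrank_range_pow_le k)
  have hA : LinearIndependent ℂ (F A) := hA
  have hcard : Fintype.card (Σ i : Fin n, Fin (size b.1 i - k)) =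
      ∑ i : Fin n, (size b.1 i - k) := by simp
  rw [← hcard, ← finrank_span_eq_card hA]
  refine Submodule.finrank_mono (Submodule.span_le.2 ?_)
  rintro _ ⟨p, rfl⟩
  exact ⟨A ^ (p.2 : ℕ) *ᵥ g p.1, (pow_add_mulVec A k p.2 (g p.1)).symm⟩

/-- `b` arises from `a` by moving one box from block `r` to block `s`, which remains
no longer than block `r`. -/
def IsBoxMove (n : ℕ) (a b : List ℕ) : Prop :=
  ∃ r s : Fin n, r ≠ s ∧ size a r = size b r + 1 ∧ size b s = size a s + 1 ∧
    size b s ≤ size b r ∧ ∀ i : Fin n, i ≠ r → i ≠ s → size a i = size b i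

instance (n : ℕ) (a b : List ℕ) : Decidable (IsBoxMove n a b) :=
  inferInstanceAs (Decidable (∃ _ _, _))

theorem Dominates.of_isBoxMove {a b : DegType n} (h : IsBoxMove n a.1 b.1) : Dominates a b := by
  obtain ⟨r, s, hrs, hr, hs, hle, hoff⟩ := h
  intro B hB
  obtain ⟨g, hg⟩ := (mem_manifold_iff b B).1 hB
  obtain ⟨E, hE⟩ := hg.exists_perturbation b.sum_size hrs hr hs hle hoff
  have hlim : Filter.Tendsto (fun ε : ℂ => B + ε • E) (nhdsWithin 0 {0}ᶜ) (nhds B) := by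
    have : Continuous fun ε : ℂ => B + ε • E := by fun_prop
    simpa using (this.tendsto 0).mono_left nhdsWithin_le_nhds
  refine mem_closure_of_tendsto hlim ?_
  filter_upwards [self_mem_nhdsWithin] with ε hε
  exact (mem_manifold_iff a _).2 (hE ε hε)

/-! ### Reduction to a finite computation -/

/-- The lists of at most `d` positive integers at most `k`, in descending order, with sum `s`. -/
def descLists : (d k s : ℕ) → List (List ℕ)
  | 0, _, s => if s = 0 then [[]] else []
  | d + 1, k, s => (if s = 0 then [[]] else []) ++
      (List.range' 1 k).flatMap fun j =>
        if j ≤ s then (descLists d j (s - j)).map (j :: ·) else []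

theorem mem_descLists {d k s : ℕ} {l : List ℕ} (hd : l.length ≤ d) (hk : ∀ x ∈ l, x ≤ k)
    (hl : l.Pairwise (· ≥ ·)) (hpos : ∀ x ∈ l, 0 < x) (hs : l.sum = s) :
    l ∈ descLists d k s := by
  induction d generalizing k s l with
  | zero =>
    obtain rfl : l = [] := List.length_eq_zero_iff.1 (Nat.le_zero.1 hd)
    obtain rfl : 0 = s := hs
    simp [descLists]
  | succ d ih =>
    rcases l with _ | ⟨x, l⟩
    · obtain rfl : 0 = s := hs
      simp [descLists]
    · rw [List.pairwise_cons] at hl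
      rw [List.forall_mem_cons] at hk hpos
      rw [List.sum_cons] at hs
      rw [descLists, List.mem_append]
      refine Or.inr (List.mem_flatMap.2 ⟨x, List.mem_range'_1.2 (by omega), ?_⟩)
      rw [if_pos (by omega)]
      exact List.mem_map_of_mem (ih (by simpa using hd) hl.1 hl.2 hpos.2 (by omega))

/-- Whether the second node can be reached from the first along at most `d` arrows. -/
def reach (arrows : List (List ℕ × List ℕ)) : ℕ → List ℕ → List ℕ → Bool
  | 0, x, y => x = y
  | d + 1, x, y => x = y || arrows.any fun p => p.1 = x && reach arrows d p.2 y

theorem reflTransGen_of_reach {arrows : List (List ℕ × List ℕ)} {d : ℕ} {x y : List ℕ}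
    (h : reach arrows d x y = true) :
    Relation.ReflTransGen (fun x y : List ℕ => (x, y) ∈ arrows) x y := by
  induction d generalizing x with
  | zero =>
    obtain rfl : x = y := by simpa [reach] using h
    exact .refl
  | succ d ih =>
    simp only [reach, Bool.or_eq_true, decide_eq_true_eq, List.any_eq_true,
      Bool.and_eq_true] at h
    rcases h with rfl | ⟨⟨_, z⟩, hp, rfl, hz⟩
    · exact .refl
    · exact .head hp (ih hz)

/-- A decidable condition on a finite directed graph under which it is the hierarchy of `n`-fold
degeneracies. -/
structure HierarchyCheck (n : ℕ) (nodes : List (List ℕ)) (arrows : List (List ℕ × List ℕ)) :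
    Prop where
  nodup : nodes.Nodup
  isType : ∀ m ∈ nodes, m.Pairwise (· ≥ ·) ∧ (∀ k ∈ m, 0 < k) ∧ m.sum = n
  complete : ∀ m ∈ descLists n n n, m ∈ nodes
  arrows_mem : ∀ p ∈ arrows, p.1 ∈ nodes ∧ p.2 ∈ nodes
  boxMove : ∀ p ∈ arrows, IsBoxMove n p.1 p.2
  reach : ∀ x ∈ nodes, ∀ y ∈ nodes, RankLE n y x → reach arrows nodes.length x y = true
  antisymm : ∀ x ∈ nodes, ∀ y ∈ nodes, RankLE n y x → RankLE n x y → x = y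
  /-- Arrows have no intermediate node; conversely a covering pair, being joined by a path, is an
  arrow. -/
  irreducible : ∀ p ∈ arrows, p.1 ≠ p.2 ∧
    ∀ z ∈ nodes, RankLE n z p.1 → RankLE n p.2 z → z = p.1 ∨ z = p.2

namespace HierarchyCheck

variable {nodes : List (List ℕ)} {arrows : List (List ℕ × List ℕ)}

theorem mem_nodes_iff (h : HierarchyCheck n nodes arrows) (m : List ℕ) :
    m ∈ nodes ↔ m.Pairwise (· ≥ ·) ∧ (∀ k ∈ m, 0 < k) ∧ m.sum = n := by
  refine ⟨h.isType m, fun hm => h.complete m ?_⟩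
  refine mem_descLists (DegType.length_le ⟨m, hm⟩) (fun x hx => ?_) hm.1 hm.2.1 hm.2.2
  exact (List.le_sum_of_mem hx).trans_eq hm.2.2

theorem coe_mem (h : HierarchyCheck n nodes arrows) (a : DegType n) : a.1 ∈ nodes :=
  (h.mem_nodes_iff _).2 a.2

theorem dominates_of_reflTransGen (h : HierarchyCheck n nodes arrows) {a b : DegType n}
    (hab : Relation.ReflTransGen (fun x y : List ℕ => (x, y) ∈ arrows) a.1 b.1) :
    Dominates a b := by
  suffices H : ∀ y, Relation.ReflTransGen (fun x y : List ℕ => (x, y) ∈ arrows) a.1 y →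
      ∀ c : DegType n, c.1 = y → Dominates a c from H _ hab b rfl
  intro y hy
  induction hy with
  | refl =>
    intro c hc
    rw [Subtype.ext hc]
    exact Dominates.refl a
  | @tail y z _ hyz ih =>
    rintro c rfl
    have hy := (h.mem_nodes_iff y).1 (h.arrows_mem _ hyz).1
    exact (ih ⟨y, hy⟩ rfl).trans (Dominates.of_isBoxMove (h.boxMove _ hyz))

theorem reflTransGen_of_rankLE (h : HierarchyCheck n nodes arrows) {a b : DegType n}
    (hab : RankLE n b.1 a.1) :
    Relation.ReflTransGen (fun x y : List ℕ => (x, y) ∈ arrows) a.1 b.1 :=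
  reflTransGen_of_reach (h.reach _ (h.coe_mem a) _ (h.coe_mem b) hab)

theorem dominates_iff (h : HierarchyCheck n nodes arrows) {a b : DegType n} :
    Dominates a b ↔ RankLE n b.1 a.1 :=
  ⟨Dominates.rankLE, fun hab => h.dominates_of_reflTransGen (h.reflTransGen_of_rankLE hab)⟩

theorem isHierarchy (h : HierarchyCheck n nodes arrows) : IsHierarchy n nodes arrows := by
  refine ⟨h.nodup, h.mem_nodes_iff, ⟨Dominates.refl, fun _ _ _ => Dominates.trans,
    fun a b hab hba => Subtype.ext (h.antisymm _ (h.coe_mem a) _ (h.coe_mem b) hab.rankLE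
      hba.rankLE)⟩, fun a b => ⟨fun hab => h.reflTransGen_of_rankLE hab.rankLE,
      h.dominates_of_reflTransGen⟩, fun x y => ⟨fun hxy => ?_, ?_⟩⟩
  · have hx := (h.mem_nodes_iff x).1 (h.arrows_mem _ hxy).1
    have hy := (h.mem_nodes_iff y).1 (h.arrows_mem _ hxy).2
    refine ⟨⟨x, hx⟩, ⟨y, hy⟩, rfl, rfl, Dominates.of_isBoxMove (h.boxMove _ hxy), fun e =>
      (h.irreducible _ hxy).1 (congrArg Subtype.val e), fun c hxc hcy => ?_⟩
    simpa only [Subtype.ext_iff] using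
      (h.irreducible _ hxy).2 c.1 (h.coe_mem c) hxc.rankLE hcy.rankLE
  · -- The first arrow on a path from `a` to `b` already ends in `b`.
    rintro ⟨a, b, rfl, rfl, hab, hne, hcov⟩
    rcases (h.reflTransGen_of_rankLE hab.rankLE).cases_head with he | ⟨z, haz, hzb⟩
    · exact absurd (Subtype.ext he) hne
    · have hz := (h.mem_nodes_iff z).1 (h.arrows_mem _ haz).2
      rcases hcov ⟨z, hz⟩ (Dominates.of_isBoxMove (h.boxMove _ haz))
        (h.dominates_of_reflTransGen hzb) with rfl | rfl
      · exact absurd rfl (h.irreducible _ haz).1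
      · exact haz

theorem domTotal (h : HierarchyCheck n nodes arrows)
    (ht : ∀ x ∈ nodes, ∀ y ∈ nodes, RankLE n y x ∨ RankLE n x y) : DomTotal n := fun a b => by
  rw [h.dominates_iff, h.dominates_iff]
  exact ht _ (h.coe_mem a) _ (h.coe_mem b)

end HierarchyCheck

end Degeneracy

/-! ### The hierarchies up to multiplicity six -/

theorem mainTheorem4 :
    -- multiplicity 2
    (Degeneracy.IsHierarchy 2
        [[2], [1, 1]]
        [([2], [1, 1])] ∧
      Degeneracy.DomTotal 2) ∧
    -- multiplicity 3
    (Degeneracy.IsHierarchy 3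
        [[3], [2, 1], [1, 1, 1]]
        [([3], [2, 1]), ([2, 1], [1, 1, 1])] ∧
      Degeneracy.DomTotal 3) ∧
    -- multiplicity 4
    (Degeneracy.IsHierarchy 4
        [[4], [3, 1], [2, 2], [2, 1, 1], [1, 1, 1, 1]]
        [([4], [3, 1]), ([3, 1], [2, 2]), ([2, 2], [2, 1, 1]), ([2, 1, 1], [1, 1, 1, 1])] ∧
      Degeneracy.DomTotal 4) ∧
    -- multiplicity 5
    (Degeneracy.IsHierarchy 5
        [[5], [4, 1], [3, 2], [3, 1, 1], [2, 2, 1], [2, 1, 1, 1], [1, 1, 1, 1, 1]]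
        [([5], [4, 1]), ([4, 1], [3, 2]), ([3, 2], [3, 1, 1]), ([3, 1, 1], [2, 2, 1]),
          ([2, 2, 1], [2, 1, 1, 1]), ([2, 1, 1, 1], [1, 1, 1, 1, 1])] ∧
      Degeneracy.DomTotal 5) ∧
    -- multiplicity 6
    (Degeneracy.IsHierarchy 6
        [[6], [5, 1], [4, 2], [4, 1, 1], [3, 3], [3, 2, 1], [3, 1, 1, 1], [2, 2, 2],
          [2, 2, 1, 1], [2, 1, 1, 1, 1], [1, 1, 1, 1, 1, 1]]
        [([6], [5, 1]), ([5, 1], [4, 2]),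
          ([4, 2], [4, 1, 1]), ([4, 2], [3, 3]),
          ([4, 1, 1], [3, 2, 1]), ([3, 3], [3, 2, 1]),
          ([3, 2, 1], [3, 1, 1, 1]), ([3, 2, 1], [2, 2, 2]),
          ([3, 1, 1, 1], [2, 2, 1, 1]), ([2, 2, 2], [2, 2, 1, 1]),
          ([2, 2, 1, 1], [2, 1, 1, 1, 1]), ([2, 1, 1, 1, 1], [1, 1, 1, 1, 1, 1])] ∧
      ¬ Degeneracy.DomTotal 6 ∧
      ¬ Degeneracy.Dominates (n := 6) ⟨[4, 1, 1], by decide⟩ ⟨[3, 3], by decide⟩ ∧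
      ¬ Degeneracy.Dominates (n := 6) ⟨[3, 3], by decide⟩ ⟨[4, 1, 1], by decide⟩ ∧
      Degeneracy.Dominates (n := 6) ⟨[4, 2], by decide⟩ ⟨[4, 1, 1], by decide⟩ ∧
      Degeneracy.Dominates (n := 6) ⟨[4, 2], by decide⟩ ⟨[3, 3], by decide⟩) := by
  have h2 : Degeneracy.HierarchyCheck 2
        [[2], [1, 1]]
        [([2], [1, 1])] := by
    constructor <;> decide +kernel
  have h3 : Degeneracy.HierarchyCheck 3
        [[3], [2, 1], [1, 1, 1]]
        [([3], [2, 1]), ([2, 1], [1, 1, 1])] := by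
    constructor <;> decide +kernel
  have h4 : Degeneracy.HierarchyCheck 4
        [[4], [3, 1], [2, 2], [2, 1, 1], [1, 1, 1, 1]]
        [([4], [3, 1]), ([3, 1], [2, 2]), ([2, 2], [2, 1, 1]), ([2, 1, 1], [1, 1, 1, 1])] := by
    constructor <;> decide +kernel
  have h5 : Degeneracy.HierarchyCheck 5
        [[5], [4, 1], [3, 2], [3, 1, 1], [2, 2, 1], [2, 1, 1, 1], [1, 1, 1, 1, 1]]
        [([5], [4, 1]), ([4, 1], [3, 2]), ([3, 2], [3, 1, 1]), ([3, 1, 1], [2, 2, 1]),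
          ([2, 2, 1], [2, 1, 1, 1]), ([2, 1, 1, 1], [1, 1, 1, 1, 1])] := by
    constructor <;> decide +kernel
  have h6 : Degeneracy.HierarchyCheck 6
        [[6], [5, 1], [4, 2], [4, 1, 1], [3, 3], [3, 2, 1], [3, 1, 1, 1], [2, 2, 2],
          [2, 2, 1, 1], [2, 1, 1, 1, 1], [1, 1, 1, 1, 1, 1]]
        [([6], [5, 1]), ([5, 1], [4, 2]),
          ([4, 2], [4, 1, 1]), ([4, 2], [3, 3]),
          ([4, 1, 1], [3, 2, 1]), ([3, 3], [3, 2, 1]),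
          ([3, 2, 1], [3, 1, 1, 1]), ([3, 2, 1], [2, 2, 2]),
          ([3, 1, 1, 1], [2, 2, 1, 1]), ([2, 2, 2], [2, 2, 1, 1]),
          ([2, 2, 1, 1], [2, 1, 1, 1, 1]), ([2, 1, 1, 1, 1], [1, 1, 1, 1, 1, 1])] := by
    constructor <;> decide +kernel
  refine ⟨⟨h2.isHierarchy, h2.domTotal ?_⟩, ⟨h3.isHierarchy, h3.domTotal ?_⟩,
    ⟨h4.isHierarchy, h4.domTotal ?_⟩, ⟨h5.isHierarchy, h5.domTotal ?_⟩, h6.isHierarchy,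
    fun ht => ?_, fun h => ?_, fun h => ?_, ?_, ?_⟩
  · decide +kernel
  · decide +kernel
  · decide +kernel
  · decide +kernel
  · rcases ht ⟨[4, 1, 1], by decide⟩ ⟨[3, 3], by decide⟩ with h | h
    · exact absurd h.rankLE (by decide +kernel)
    · exact absurd h.rankLE (by decide +kernel)
  · exact absurd h.rankLE (by decide +kernel)
  · exact absurd h.rankLE (by decide +kernel)
  · exact h6.dominates_iff.2 (by decide +kernel)
  · exact h6.dominates_iff.2 (by decide +kernel)
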